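/- Let $d\ge 1$ and let $[X_{n,i}]_{1\le i\le n,\ n\ge 1}$ be a triangular array of $\mathbb{R}^d$-valued random variables on a common probability space $(\Omega,\mathcal F,\mathrm P)$, all having the same marginal law $\mu$ on $\mathbb{R}^d$ (no other condition on $\mu$ is imposed). For $m\ge 1$ let \[ \alpha_m := \sup_{n\ge 1}\ \sup_{1\le j\le n-m}\ \sup\Big\{|\mathrm P(A\cap B)-\mathrm P(A)\mathrm P(B)| : A\in\sigma(X_{n,i}:1\le i\le j),\ B\in\sigma(X_{n,i}: j+m\le i\le n)\Big\} \] be its strong mixing coefficients. Assume that the array is $\alpha$-mixing, that is, $\alpha_m\to 0$ as $m\to\infty$, and that there are $\gamma>1$ and $C<\infty$ with $\alpha_m\le C\,m^{-\gamma}$ for all $m\ge 1$. Let $(k_n)_{n\ge 1}$ be positive integers with $k_n/n\to 0$ as $n\to\infty$. Fix $x\in\mathbb{R}^d$ and, for every $n$ with $k_n\le n$ (hence for all large $n$), let $\mathcal X^n_{(k_n)}(x)$ be the $k_n$-th nearest neighbor of $x$ in Euclidean distance among $X_{n,1},\dots,X_{n,n}$, with ties broken arbitrarily. Let $\mathrm{supp}(\mu)$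 be the set of all $y\in\mathbb{R}^d$ such that every closed ball of positive radius centered at $y$ has positive $\mu$-measure, and let $r_x:=\inf_{y\in\mathrm{supp}(\mu)}\|y-x\|$. Then \[ \|\mathcal X^n_{(k_n)}(x)-x\| \longrightarrow r_x \quad\text{almost surely as } n\to\infty. \] In particular, if $x\in\mathrm{supp}(\mu)$, then $\|\mathcal X^n_{(k_n)}(x)-x\|\to 0$ almost surely. -/

import Mathlib

open MeasureTheory Filter Topology

/-- The σ-field generated by the segment `X n k, …, X n m` of the `n`th row of the array. -/
abbrev rowSigma {Ω E : Type*} [MeasurableSpace E] (X : ℕ → ℕ → Ω → E) (n k m : ℕ) :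
    MeasurableSpace Ω :=
  ⨆ i ∈ Set.Icc k m, MeasurableSpace.comap (X n i) inferInstance

/-- The set of all `|P(A ∩ B) - P(A) P(B)|`, where for some row `n` and some `1 ≤ k ≤ n - m` the
event `A` depends on `X n 1, …, X n k` and the event `B` depends on `X n (k + m), …, X n n`. -/
def mixingGaps {Ω E : Type*} [MeasurableSpace Ω] [MeasurableSpace E]
    (P : Measure Ω) (X : ℕ → ℕ → Ω → E) (m : ℕ) : Set ℝ :=
  {a | ∃ n k : ℕ, 1 ≤ k ∧ k + m ≤ n ∧ ∃ A B : Set Ω,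
    MeasurableSet[rowSigma X n 1 k] A ∧ MeasurableSet[rowSigma X n (k + m) n] B ∧
    a = |P.real (A ∩ B) - P.real A * P.real B|}

/-- The strong mixing coefficient `α_m` of a triangular array. -/
noncomputable def alphaCoeff {Ω E : Type*} [MeasurableSpace Ω] [MeasurableSpace E]
    (P : Measure Ω) (X : ℕ → ℕ → Ω → E) (m : ℕ) : ℝ :=
  sSup (mixingGaps P X m)

/-- The supremum defining `alphaCoeff` is over a bounded set. -/
theorem bddAbove_mixingGaps {Ω E : Type*} [MeasurableSpace Ω] [MeasurableSpace E]
    (P : Measure Ω) [IsProbabilityMeasure P] (X : ℕ → ℕ → Ω → E) (m : ℕ) :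
    BddAbove (mixingGaps P X m) := by
  refine ⟨1, ?_⟩
  rintro a ⟨n, k, -, -, A, B, -, -, rfl⟩
  have h1 : P.real (A ∩ B) ≤ 1 := measureReal_le_one
  have h2 : 0 ≤ P.real (A ∩ B) := measureReal_nonneg
  have h3 : P.real A ≤ 1 := measureReal_le_one
  have h4 : 0 ≤ P.real A := measureReal_nonneg
  have h5 : P.real B ≤ 1 := measureReal_le_one
  have h6 : 0 ≤ P.real B := measureReal_nonneg
  rw [abs_le]
  constructor <;> nlinarith [mul_nonneg h4 h6, mul_le_one₀ h3 h6 h5]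

/-- The supremum defining `alphaCoeff` is over a non-empty set. -/
theorem mixingGaps_nonempty {Ω E : Type*} [MeasurableSpace Ω] [MeasurableSpace E]
    (P : Measure Ω) (X : ℕ → ℕ → Ω → E) (m : ℕ) : (mixingGaps P X m).Nonempty :=
  ⟨_, m + 1, 1, le_rfl, by omega, ∅, ∅, @MeasurableSet.empty _ (rowSigma X (m + 1) 1 1),
    @MeasurableSet.empty _ (rowSigma X (m + 1) (1 + m) (m + 1)), rfl⟩

/-- The array is strong mixing (`α`-mixing): `α_m → 0`. -/
def IsAlphaMixing {Ω E : Type*} [MeasurableSpace Ω] [MeasurableSpace E]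
    (P : Measure Ω) (X : ℕ → ℕ → Ω → E) : Prop :=
  Tendsto (fun m : ℕ => alphaCoeff P X m) atTop (𝓝 0)

/-- `y` is a `k`th nearest neighbor of `x` among the points `p 1, …, p n`: after reordering them
by a permutation `σ` of `{1, …, n}` so that the distance to `x` is nondecreasing, `y` is the `k`th
point. The freedom in `σ` is exactly the freedom in breaking ties. -/
def IsKthNearest {E : Type*} [NormedAddCommGroup E] (p : ℕ → E) (n k : ℕ) (x y : E) : Prop :=
  ∃ σ : ℕ → ℕ, Set.BijOn σ (Set.Icc 1 n) (Set.Icc 1 n) ∧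
    MonotoneOn (fun j => ‖p (σ j) - x‖) (Set.Icc 1 n) ∧ y = p (σ k)

/-- A `k`th nearest neighbor always exists. -/
theorem exists_isKthNearest {E : Type*} [NormedAddCommGroup E] (p : ℕ → E) (n k : ℕ) (x : E) :
    ∃ y, IsKthNearest p n k x y := by
  classical
  let s : Equiv.Perm (Fin n) := Tuple.sort (fun i : Fin n => ‖p (i + 1) - x‖)
  have hs : Monotone ((fun i : Fin n => ‖p (i + 1) - x‖) ∘ s) :=
    Tuple.monotone_sort (fun i : Fin n => ‖p (i + 1) - x‖)
  let σ : ℕ → ℕ := fun j => if h : j - 1 < n then (s ⟨j - 1, h⟩ : ℕ) + 1 else 0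
  have hσ : ∀ (j : ℕ) (h : j - 1 < n), σ j = (s ⟨j - 1, h⟩ : ℕ) + 1 := fun j h => by
    simp [σ, h]
  refine ⟨p (σ k), σ, ⟨?_, ?_, ?_⟩, ?_, rfl⟩
  · intro j hj
    have h : j - 1 < n := by have := hj.1; have := hj.2; omega
    rw [hσ j h]
    have := (s ⟨j - 1, h⟩).2
    exact ⟨by omega, by omega⟩
  · intro i hi j hj hij
    have h1 : i - 1 < n := by have := hi.1; have := hi.2; omega
    have h2 : j - 1 < n := by have := hj.1; have := hj.2; omega
    rw [hσ i h1, hσ j h2, Nat.add_right_cancel_iff, ← Fin.ext_iff, s.injective.eq_iff,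
      Fin.mk.injEq] at hij
    have := hi.1
    have := hj.1
    omega
  · intro j hj
    have h : j - 1 < n := by have := hj.1; have := hj.2; omega
    refine ⟨(s.symm ⟨j - 1, h⟩ : ℕ) + 1, ⟨by omega, (s.symm ⟨j - 1, h⟩).2⟩, ?_⟩
    have h' : (s.symm ⟨j - 1, h⟩ : ℕ) + 1 - 1 < n := by simp
    rw [hσ _ h']
    have := hj.1
    simp
    omega
  · intro i hi j hj hij
    have h1 : i - 1 < n := by have := hi.1; have := hi.2; omega
    have h2 : j - 1 < n := by have := hj.1; have := hj.2; omega
    have := hs (show (⟨i - 1, h1⟩ : Fin n) ≤ ⟨j - 1, h2⟩ by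
      simp only [Fin.mk_le_mk]; omega)
    simpa only [hσ i h1, hσ j h2, Function.comp] using this

/-- Membership in the support of a measure is positivity of the mass of all closed balls. -/
theorem mem_support_iff_closedBall {E : Type*} [PseudoMetricSpace E] [MeasurableSpace E]
    (μ : Measure E) (x : E) :
    x ∈ μ.support ↔ ∀ r : ℝ, 0 < r → 0 < μ (Metric.closedBall x r) := by
  simpa using Metric.nhds_basis_closedBall.mem_measureSupport (μ := μ) (x := x)

/-! Almost surely every sample point lies in the support of `μ`, so no neighbor is closer to `x`
than `r_x`. For the upper bound, a ball around `x` of radius `r > r_x` is a neighborhood of a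
support point and so has mass `p > 0`; since `k n = o(n)`, it suffices that the row visits this ball
at least `c * n` times eventually, with `c > 0`.

Summable covariances and Chebyshev bound the probability of too few visits only by `O(1/n)`, which
is not summable. The remedy is to look at the first and last of three blocks of length `n / 3`: if
the row has too few visits, both blocks do, and by mixing across the middle block this has
probability `O(n⁻²) + α_{n/3+1} = O(n⁻² + n^(-γ))`. This is summable because `γ > 1`, and
Borel–Cantelli applies (`ae_eventually_le_sum_indicator`). -/

/-- Double sums of a summable function of the distance grow at most linearly. -/
theorem sum_sum_natDist_le {a : ℕ → ℝ} (ha0 : ∀ m, 0 ≤ a m) (ha : Summable a) (s : Finset ℕ) :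
    ∑ i ∈ s, ∑ j ∈ s, a (Nat.dist i j) ≤ s.card * (2 * ∑' m, a m) := by
  rw [← nsmul_eq_mul]
  refine Finset.sum_le_card_nsmul _ _ _ fun i _ => ?_
  -- On each side of `i` the map `j ↦ Nat.dist i j` is injective, so each half is at most the full
  -- series.
  rw [← Finset.sum_filter_add_sum_filter_not s (fun j => i ≤ j), two_mul]
  refine add_le_add ?_ ?_
  · rw [← Finset.sum_image (f := a) (g := Nat.dist i) (s := s.filter (fun j => i ≤ j))]
    · exact ha.sum_le_tsum _ fun m _ => ha0 m
    · intro j hj l hl h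
      simp only [Finset.coe_filter, Set.mem_ofPred_eq, Nat.dist] at hj hl h
      omega
  · rw [← Finset.sum_image (f := a) (g := Nat.dist i) (s := s.filter (fun j => ¬ i ≤ j))]
    · exact ha.sum_le_tsum _ fun m _ => ha0 m
    · intro j hj l hl h
      simp only [Finset.coe_filter, Set.mem_ofPred_eq, Nat.dist] at hj hl h
      omega

open ProbabilityTheory in
/-- Chebyshev's lower tail bound for the number of occurring events, when these have the same
probability and their covariances are bounded by a summable function of the distance. -/
theorem measureReal_sum_indicator_lt_le {Ω : Type*} [MeasurableSpace Ω] (P : Measure Ω)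
    [IsProbabilityMeasure P] {A : ℕ → Set Ω} {s : Finset ℕ} (hs : s.Nonempty)
    (hA : ∀ i ∈ s, MeasurableSet (A i)) {p : ℝ} (hp : 0 < p) (hAp : ∀ i ∈ s, P.real (A i) = p)
    {a : ℕ → ℝ} (ha0 : ∀ m, 0 ≤ a m) (ha : Summable a)
    (hcov : ∀ i ∈ s, ∀ j ∈ s, i ≤ j → |P.real (A i ∩ A j) - p * p| ≤ a (j - i)) :
    P.real {ω | ∑ i ∈ s, (A i).indicator (1 : Ω → ℝ) ω < p * s.card / 2} ≤
      8 * (∑' m, a m) / (p ^ 2 * s.card) := by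
  have hc : (0 : ℝ) < s.card := by exact_mod_cast hs.card_pos
  have hL : ∀ i ∈ s, MemLp ((A i).indicator (1 : Ω → ℝ)) 2 P := fun i hi =>
    memLp_indicator_const 2 (hA i hi) (1 : ℝ) (Or.inr (measure_ne_top P _))
  have hE : ∀ B : Set Ω, MeasurableSet B → ∫ ω, B.indicator (1 : Ω → ℝ) ω ∂P = P.real B :=
    fun B hB => integral_indicator_one hB
  have hcov' : ∀ i ∈ s, ∀ j ∈ s, covariance ((A i).indicator (1 : Ω → ℝ))
      ((A j).indicator (1 : Ω → ℝ)) P ≤ a (Nat.dist i j) := by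
    intro i hi j hj
    have hmul : (A i).indicator (1 : Ω → ℝ) * (A j).indicator (1 : Ω → ℝ)
        = (A i ∩ A j).indicator (1 : Ω → ℝ) := by
      rw [Set.inter_indicator_one]
    rw [covariance_eq_sub (hL i hi) (hL j hj), hmul, hE _ ((hA i hi).inter (hA j hj)),
      hE _ (hA i hi), hE _ (hA j hj), hAp i hi, hAp j hj]
    rcases le_total i j with h | h
    · rw [Nat.dist_eq_sub_of_le h]
      exact (le_abs_self _).trans (hcov i hi j hj h)
    · rw [Nat.dist_eq_sub_of_le_right h, Set.inter_comm]
      exact (le_abs_self _).trans (hcov j hj i hi h)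
  have hvar : variance (fun ω => ∑ i ∈ s, (A i).indicator (1 : Ω → ℝ) ω) P ≤
      s.card * (2 * ∑' m, a m) := by
    rw [variance_fun_sum' hL]
    exact (Finset.sum_le_sum fun i hi => Finset.sum_le_sum fun j hj => hcov' i hi j hj).trans
      (sum_sum_natDist_le ha0 ha s)
  have hmean : ∫ ω, ∑ i ∈ s, (A i).indicator (1 : Ω → ℝ) ω ∂P = p * s.card := by
    rw [integral_finsetSum _ fun i hi => (hL i hi).integrable one_le_two,
      Finset.sum_congr rfl fun i hi => (hE _ (hA i hi)).trans (hAp i hi)]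
    simp [mul_comm]
  have hpos : 0 < p * s.card / 2 := by positivity
  -- Falling below half the mean is a deviation of at least `p * s.card / 2`; squaring turns the
  -- factor 2 of the variance bound into 8.
  have hcheb := meas_ge_le_variance_div_sq (memLp_finsetSum s hL) hpos
  have h1 : P.real {ω | ∑ i ∈ s, (A i).indicator (1 : Ω → ℝ) ω < p * s.card / 2} ≤
      variance (fun ω => ∑ i ∈ s, (A i).indicator (1 : Ω → ℝ) ω) P / (p * s.card / 2) ^ 2 := by
    refine ENNReal.toReal_le_of_le_ofReal (div_nonneg (variance_nonneg _ _) (sq_nonneg _))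
      ((measure_mono fun ω hω => ?_).trans hcheb)
    simp only [Set.mem_ofPred_eq, hmean] at hω ⊢
    rw [abs_sub_comm]
    exact le_trans (by linarith) (le_abs_self _)
  refine h1.trans ?_
  calc _ ≤ s.card * (2 * ∑' m, a m) / (p * s.card / 2) ^ 2 := by gcongr
    _ = _ := by field_simp; ring

/-! ### Consequences of polynomial mixing for visit counts -/

section Mixing

variable {Ω E : Type*} [MeasurableSpace E] {X : ℕ → ℕ → Ω → E}

theorem measurableSet_preimage_rowSigma {n k m i : ℕ} (hi : i ∈ Set.Icc k m) {B : Set E}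
    (hB : MeasurableSet B) : MeasurableSet[rowSigma X n k m] (X n i ⁻¹' B) :=
  le_iSup₂_of_le (f := fun i (_ : i ∈ Set.Icc k m) => MeasurableSpace.comap (X n i) inferInstance)
    i hi le_rfl _ ⟨B, hB, rfl⟩

theorem measurableSet_sum_indicator_lt_rowSigma {n k m : ℕ} {s : Finset ℕ}
    (hs : ∀ i ∈ s, i ∈ Set.Icc k m) {B : Set E} (hB : MeasurableSet B) (t : ℝ) :
    MeasurableSet[rowSigma X n k m]
      {ω | ∑ i ∈ s, (X n i ⁻¹' B).indicator (1 : Ω → ℝ) ω < t} := by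
  have hmeas : Measurable[rowSigma X n k m]
      fun ω => ∑ i ∈ s, (X n i ⁻¹' B).indicator (1 : Ω → ℝ) ω :=
    @Finset.measurable_sum _ _ _ _ _ _ (rowSigma X n k m) _ s fun i hi =>
      (@measurable_one _ _ _ (rowSigma X n k m) _).indicator
        (measurableSet_preimage_rowSigma (hs i hi) hB)
  exact hmeas measurableSet_Iio

variable [MeasurableSpace Ω] {P : Measure Ω}

theorem alphaCoeff_nonneg (P : Measure Ω) (X : ℕ → ℕ → Ω → E) (m : ℕ) : 0 ≤ alphaCoeff P X m :=
  Real.sSup_nonneg fun _ ⟨_, _, _, _, _, _, _, _, h⟩ => h ▸ abs_nonneg _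

theorem summable_alphaCoeff {C γ : ℝ} (hγ : 1 < γ)
    (hα : ∀ m : ℕ, 1 ≤ m → alphaCoeff P X m ≤ C * (m : ℝ) ^ (-γ)) :
    Summable (alphaCoeff P X) := by
  have h : Summable fun m : ℕ => C * (m : ℝ) ^ (-γ) :=
    (Real.summable_nat_rpow.2 (by linarith)).mul_left C
  refine (summable_nat_add_iff 1).1 (Summable.of_nonneg_of_le
    (fun m => alphaCoeff_nonneg P X _) (fun m => hα (m + 1) (by omega))
    ((summable_nat_add_iff 1).2 h))

variable [IsProbabilityMeasure P]

theorem abs_measureReal_inter_sub_le_alphaCoeff {n k m : ℕ} (hk : 1 ≤ k) (hkm : k + m ≤ n)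
    {A B : Set Ω} (hA : MeasurableSet[rowSigma X n 1 k] A)
    (hB : MeasurableSet[rowSigma X n (k + m) n] B) :
    |P.real (A ∩ B) - P.real A * P.real B| ≤ alphaCoeff P X m :=
  le_csSup (bddAbove_mixingGaps P X m) ⟨n, k, hk, hkm, A, B, hA, hB, rfl⟩

/-- The number of visits of the `n`th row to a set of positive probability is a.s. eventually
at least proportional to `n`. -/
theorem ae_eventually_le_sum_indicator
    (hX : ∀ n i : ℕ, 1 ≤ i → i ≤ n → Measurable (X n i))
    {μ : Measure E} (hμ : ∀ n i : ℕ, 1 ≤ i → i ≤ n → P.map (X n i) = μ)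
    {C γ : ℝ} (hγ : 1 < γ) (hα : ∀ m : ℕ, 1 ≤ m → alphaCoeff P X m ≤ C * (m : ℝ) ^ (-γ))
    {B : Set E} (hB : MeasurableSet B) (hp : 0 < μ.real B) :
    ∀ᵐ ω ∂P, ∀ᶠ n : ℕ in atTop, μ.real B / 12 * n ≤
      ∑ i ∈ Finset.Icc 1 n, (X n i ⁻¹' B).indicator (1 : Ω → ℝ) ω := by
  set p := μ.real B with hpdef
  set a := alphaCoeff P X with hadef
  have ha0 : ∀ m, 0 ≤ a m := alphaCoeff_nonneg P X
  have ha : Summable a := summable_alphaCoeff hγ hα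
  have hC : 0 ≤ C := by simpa using (ha0 1).trans (hα 1 le_rfl)
  have hreal : ∀ n i : ℕ, 1 ≤ i → i ≤ n → P.real (X n i ⁻¹' B) = p := fun n i h1 h2 => by
    rw [hpdef, ← hμ n i h1 h2, map_measureReal_apply (hX n i h1 h2) hB]
  have hcov : ∀ n i j : ℕ, 1 ≤ i → i ≤ j → j ≤ n →
      |P.real (X n i ⁻¹' B ∩ X n j ⁻¹' B) - p * p| ≤ a (j - i) := fun n i j h1 h2 h3 => by
    -- Gap `0` is allowed, so the diagonal `i = j` is covered by `α_0`.
    have h := abs_measureReal_inter_sub_le_alphaCoeff (P := P) (X := X) (n := n) (k := i)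
      (m := j - i) h1 (by omega)
      (measurableSet_preimage_rowSigma (i := i) ⟨h1, le_rfl⟩ hB)
      (measurableSet_preimage_rowSigma (i := j) ⟨by omega, h3⟩ hB)
    rwa [hreal n i h1 (h2.trans h3), hreal n j (h1.trans h2) h3] at h
  let few (n : ℕ) (s : Finset ℕ) : Set Ω :=
    {ω | ∑ i ∈ s, (X n i ⁻¹' B).indicator (1 : Ω → ℝ) ω < p * s.card / 2}
  set K := 8 * (∑' m, a m) / p ^ 2 with hK
  have hfew : ∀ (n : ℕ) (s : Finset ℕ), s.Nonempty → s ⊆ Finset.Icc 1 n →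
      P.real (few n s) ≤ K / s.card := fun n s hs hsn => by
    have hs' : ∀ i ∈ s, 1 ≤ i ∧ i ≤ n := fun i hi => Finset.mem_Icc.1 (hsn hi)
    rw [hK, div_div]
    exact measureReal_sum_indicator_lt_le P hs
      (fun i hi => hX n i (hs' i hi).1 (hs' i hi).2 hB) hp
      (fun i hi => hreal n i (hs' i hi).1 (hs' i hi).2) ha0 ha
      (fun i hi j hj hij => hcov n i j (hs' i hi).1 hij (hs' j hj).2)
  -- First and third blocks; their nearest indices differ by `n / 3 + 1`.
  let F (n : ℕ) : Finset ℕ := Finset.Icc 1 (n / 3)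
  let G (n : ℕ) : Finset ℕ := Finset.Icc (2 * (n / 3) + 1) (3 * (n / 3))
  have hFc : ∀ n, (F n).card = n / 3 := fun n => by simp [F]
  have hGc : ∀ n, (G n).card = n / 3 := fun n => by simp only [G, Nat.card_Icc]; omega
  have hthird : ∀ n : ℕ, 4 ≤ n → (n : ℝ) / 6 ≤ (n / 3 : ℕ) := fun n hn => by
    rw [div_le_iff₀ (by norm_num)]
    exact_mod_cast (by omega : n ≤ n / 3 * 6)
  have hbound : ∀ n : ℕ, 4 ≤ n → P.real (few n (F n) ∩ few n (G n)) ≤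
      36 * K ^ 2 * (1 / (n : ℝ) ^ 2) + C * 3 ^ γ * (n : ℝ) ^ (-γ) := by
    intro n hn
    have hn0 : (0 : ℝ) < n := by exact_mod_cast (by omega : 0 < n)
    have hL : (0 : ℝ) < (n / 3 : ℕ) := lt_of_lt_of_le (by positivity) (hthird n hn)
    have hK0 : 0 ≤ K := div_nonneg (mul_nonneg (by norm_num) (tsum_nonneg ha0)) (sq_nonneg _)
    have h1 : P.real (few n (F n)) ≤ K / (n / 3 : ℕ) := by
      have := hfew n (F n) (Finset.card_pos.1 (by rw [hFc]; omega))
        (Finset.Icc_subset_Icc le_rfl (by omega))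
      rwa [hFc] at this
    have h2 : P.real (few n (G n)) ≤ K / (n / 3 : ℕ) := by
      have := hfew n (G n) (Finset.card_pos.1 (by rw [hGc]; omega))
        (Finset.Icc_subset_Icc (by omega) (by omega))
      rwa [hGc] at this
    have h3 := abs_measureReal_inter_sub_le_alphaCoeff (P := P) (X := X) (n := n) (k := n / 3)
      (m := n / 3 + 1) (by omega) (by omega)
      (measurableSet_sum_indicator_lt_rowSigma (s := F n)
        (fun i hi => Finset.mem_Icc.1 hi) hB (p * (F n).card / 2))
      (measurableSet_sum_indicator_lt_rowSigma (s := G n)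
        (fun i hi => by have := Finset.mem_Icc.1 hi; exact ⟨by omega, by omega⟩) hB
        (p * (G n).card / 2))
    have h5 : P.real (few n (F n)) * P.real (few n (G n)) ≤ 36 * K ^ 2 * (1 / (n : ℝ) ^ 2) :=
      calc _ ≤ K / (n / 3 : ℕ) * (K / (n / 3 : ℕ)) :=
            mul_le_mul h1 h2 measureReal_nonneg (by positivity)
        _ ≤ K / (n / 6) * (K / (n / 6)) := by
            have := hthird n hn
            gcongr
        _ = _ := by field_simp; ring
    have h6 : a (n / 3 + 1) ≤ C * 3 ^ γ * (n : ℝ) ^ (-γ) :=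
      calc _ ≤ C * ((n / 3 + 1 : ℕ) : ℝ) ^ (-γ) := hα _ (by omega)
        _ ≤ C * ((n : ℝ) / 3) ^ (-γ) := by
            refine mul_le_mul_of_nonneg_left (Real.rpow_le_rpow_of_nonpos (by positivity) ?_
              (by linarith)) hC
            rw [div_le_iff₀ (by norm_num)]
            exact_mod_cast (by omega : n ≤ (n / 3 + 1) * 3)
        _ = _ := by
            rw [Real.div_rpow hn0.le (by norm_num), Real.rpow_neg (by norm_num : (0 : ℝ) ≤ 3),
              div_inv_eq_mul]
            ring
    have h4 : P.real (few n (F n) ∩ few n (G n)) - P.real (few n (F n)) * P.real (few n (G n))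
        ≤ a (n / 3 + 1) := (le_abs_self _).trans h3
    linarith
  have hsum : Summable fun n : ℕ => P.real (few n (F n) ∩ few n (G n)) := by
    have hbig : Summable fun n : ℕ =>
        36 * K ^ 2 * (1 / (n : ℝ) ^ 2) + C * 3 ^ γ * (n : ℝ) ^ (-γ) :=
      ((Real.summable_one_div_nat_pow.2 one_lt_two).mul_left _).add
        ((Real.summable_nat_rpow.2 (by linarith)).mul_left _)
    refine (summable_nat_add_iff 4).1 ?_
    exact Summable.of_nonneg_of_le (fun n => measureReal_nonneg)
      (fun n => hbound (n + 4) (by omega)) ((summable_nat_add_iff 4).2 hbig)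
  have hBC : ∑' n : ℕ, P (few n (F n) ∩ few n (G n)) ≠ ⊤ := by
    have := hsum.tsum_ofReal_ne_top
    simpa only [ofReal_measureReal (measure_ne_top P _)] using this
  filter_upwards [ae_eventually_notMem hBC] with ω hω
  filter_upwards [hω, eventually_ge_atTop 4] with n hn hn4
  have hmono : ∀ s ⊆ Finset.Icc 1 n, ∑ i ∈ s, (X n i ⁻¹' B).indicator (1 : Ω → ℝ) ω ≤
      ∑ i ∈ Finset.Icc 1 n, (X n i ⁻¹' B).indicator (1 : Ω → ℝ) ω := fun s hs =>
    Finset.sum_le_sum_of_subset_of_nonneg hs fun i _ _ =>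
      Set.indicator_nonneg (fun _ _ => zero_le_one) ω
  -- Half the mean count of one block: the 12 is 2 times the 6 of `hthird`.
  have hthird' : p / 12 * n ≤ p * (n / 3 : ℕ) / 2 := by
    have := mul_le_mul_of_nonneg_left (hthird n hn4) hp.le
    linarith
  rw [Set.mem_inter_iff, not_and_or] at hn
  rcases hn with h | h
  · simp only [few, Set.mem_ofPred_eq, not_lt, hFc] at h
    exact hthird'.trans (h.trans (hmono _ (Finset.Icc_subset_Icc le_rfl (by omega))))
  · simp only [few, Set.mem_ofPred_eq, not_lt, hGc] at h
    exact hthird'.trans (h.trans (hmono _ (Finset.Icc_subset_Icc (by omega) (by omega))))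

end Mixing

/-! ### Deterministic facts on nearest neighbors -/

section Nearest

variable {E : Type*} [NormedAddCommGroup E] {p : ℕ → E} {n k : ℕ} {x y : E}

theorem IsKthNearest.exists_eq (h : IsKthNearest p n k x y) (hk : 1 ≤ k) (hkn : k ≤ n) :
    ∃ i, 1 ≤ i ∧ i ≤ n ∧ y = p i := by
  obtain ⟨σ, hσ, -, rfl⟩ := h
  exact ⟨σ k, (hσ.mapsTo ⟨hk, hkn⟩).1, (hσ.mapsTo ⟨hk, hkn⟩).2, rfl⟩

open Classical in
/-- If at least `k` of the points are in the ball, then so is the `k`th nearest neighbor. -/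
theorem IsKthNearest.norm_sub_lt (h : IsKthNearest p n k x y) (hk : 1 ≤ k) (hkn : k ≤ n) {r : ℝ}
    (hr : k ≤ ((Finset.Icc 1 n).filter fun i => ‖p i - x‖ < r).card) : ‖y - x‖ < r := by
  obtain ⟨σ, hσ, hmono, rfl⟩ := h
  by_contra! hcon
  -- If the `k`th point is at distance at least `r`, monotonicity leaves only ranks below `k` for
  -- points inside the ball, hence at most `k - 1` of them.
  have hsub : ((Finset.Icc 1 n).filter fun i => ‖p i - x‖ < r) ⊆
      (Finset.Icc 1 (k - 1)).image σ := by
    intro i hi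
    obtain ⟨hi1, hi2⟩ := Finset.mem_filter.1 hi
    obtain ⟨j, hj, rfl⟩ := hσ.surjOn (Finset.mem_Icc.1 hi1 : i ∈ Set.Icc 1 n)
    refine Finset.mem_image_of_mem σ (Finset.mem_Icc.2 ⟨hj.1, ?_⟩)
    by_contra! hkj
    have := hmono ⟨hk, hkn⟩ hj (by omega : k ≤ j)
    exact absurd hi2 (not_lt.2 (hcon.trans this))
  have := (Finset.card_le_card hsub).trans Finset.card_image_le
  simp only [Nat.card_Icc] at this
  omega

end Nearest

/-! ### Convergence of the nearest neighbor distance -/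

theorem theorem1 {Ω : Type*} [MeasurableSpace Ω] (P : Measure Ω) [IsProbabilityMeasure P]
    (d : ℕ) (hd : 1 ≤ d)
    -- the triangular array; only the entries `X n i` with `1 ≤ i ≤ n` matter
    (X : ℕ → ℕ → Ω → EuclideanSpace ℝ (Fin d))
    (hX : ∀ n i : ℕ, 1 ≤ i → i ≤ n → Measurable (X n i))
    -- the common marginal law
    (μ : Measure (EuclideanSpace ℝ (Fin d)))
    (hμ : ∀ n i : ℕ, 1 ≤ i → i ≤ n → P.map (X n i) = μ)
    -- polynomial strong mixing
    (hmix : IsAlphaMixing P X)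
    (γ : ℝ) (hγ : 1 < γ)
    (hα : ∃ C : ℝ, ∀ m : ℕ, 1 ≤ m → alphaCoeff P X m ≤ C * (m : ℝ) ^ (-γ))
    -- the number of neighbors
    (k : ℕ → ℕ) (hk : ∀ n : ℕ, 1 ≤ n → 1 ≤ k n)
    (hkn : Tendsto (fun n : ℕ => (k n : ℝ) / (n : ℝ)) atTop (𝓝 0))
    -- the query point and its `k n`-th nearest neighbor in the `n`th row (ties broken arbitrarily)
    (x : EuclideanSpace ℝ (Fin d))
    (Y : ℕ → Ω → EuclideanSpace ℝ (Fin d))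
    (hY : ∀ n : ℕ, 1 ≤ n → k n ≤ n → ∀ ω : Ω,
      IsKthNearest (fun i => X n i ω) n (k n) x (Y n ω)) :
    (∀ᵐ ω ∂P, Tendsto (fun n : ℕ => ‖Y n ω - x‖) atTop (𝓝 (Metric.infDist x μ.support))) ∧
    (x ∈ μ.support → ∀ᵐ ω ∂P, Tendsto (fun n : ℕ => ‖Y n ω - x‖) atTop (𝓝 0)) :=by
  obtain ⟨C, hα⟩ := hα
  have hne : μ.support.Nonempty := by
    have hprob : IsProbabilityMeasure μ :=
      hμ 1 1 le_rfl le_rfl ▸ Measure.isProbabilityMeasure_map (hX 1 1 le_rfl le_rfl).aemeasurable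
    exact Measure.nonempty_support (IsProbabilityMeasure.ne_zero μ)
  have hkn_le : ∀ c : ℝ, 0 < c → ∀ᶠ n : ℕ in atTop, (k n : ℝ) ≤ c * n := fun c hc => by
    filter_upwards [hkn.eventually (gt_mem_nhds hc), eventually_ge_atTop 1] with n hn h1
    have hn0 : (0 : ℝ) < n := by exact_mod_cast h1
    exact ((div_lt_iff₀ hn0).1 hn).le
  have hk_le : ∀ᶠ n in atTop, k n ≤ n := by
    filter_upwards [hkn_le 1 one_pos] with n hn
    exact_mod_cast hn.trans_eq (one_mul _)
  have hsupp : ∀ᵐ ω ∂P, ∀ n i : ℕ, 1 ≤ i → i ≤ n → X n i ω ∈ μ.support := by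
    simp only [ae_all_iff]
    intro n i h1 h2
    have h : ∀ᵐ y ∂(P.map (X n i)), y ∈ μ.support := by
      rw [hμ n i h1 h2]
      exact Measure.support_mem_ae
    exact ae_of_ae_map (hX n i h1 h2).aemeasurable h
  -- Countably many radii decreasing to `r_x`, so that the exceptional null sets can be united.
  have hupper : ∀ j : ℕ, ∀ᵐ ω ∂P, ∀ᶠ n in atTop,
      ‖Y n ω - x‖ < Metric.infDist x μ.support + 1 / ((j : ℝ) + 1) := by
    intro j
    set r := Metric.infDist x μ.support + 1 / ((j : ℝ) + 1)
    have hr : Metric.infDist x μ.support < r := lt_add_of_pos_right _ (by positivity)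
    obtain ⟨y, hy, hxy⟩ := (Metric.infDist_lt_iff hne).1 hr
    have hpos : 0 < μ (Metric.ball x r) :=
      Measure.mem_support_iff_forall y |>.1 hy _
        (Metric.isOpen_ball.mem_nhds (by rwa [Metric.mem_ball, dist_comm]))
    have hfin : IsFiniteMeasure μ := hμ 1 1 le_rfl le_rfl ▸ inferInstance
    have hp : 0 < μ.real (Metric.ball x r) := ENNReal.toReal_pos hpos.ne' (measure_ne_top μ _)
    filter_upwards [ae_eventually_le_sum_indicator hX hμ hγ hα Metric.isOpen_ball.measurableSet hp]
      with ω hω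
    filter_upwards [hω, hkn_le _ (div_pos hp (by norm_num : (0 : ℝ) < 12)), hk_le,
      eventually_ge_atTop 1] with n hn hkn' hle h1
    classical
    refine (hY n h1 hle ω).norm_sub_lt (hk n h1) hle ?_
    have hcount : ∑ i ∈ Finset.Icc 1 n, (X n i ⁻¹' Metric.ball x r).indicator (1 : Ω → ℝ) ω =
        ((Finset.Icc 1 n).filter fun i => ‖X n i ω - x‖ < r).card := by
      simp [Set.indicator_apply, dist_eq_norm]
    rw [hcount] at hn
    have hle' : k n ≤ ((Finset.Icc 1 n).filter fun i => ‖X n i ω - x‖ < r).card := by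
      exact_mod_cast hkn'.trans hn
    convert hle'
  have hmain : ∀ᵐ ω ∂P,
      Tendsto (fun n : ℕ => ‖Y n ω - x‖) atTop (𝓝 (Metric.infDist x μ.support)) := by
    filter_upwards [hsupp, ae_all_iff.2 hupper] with ω hlow hup
    refine tendsto_order.2 ⟨fun b hb => ?_, fun b hb => ?_⟩
    · filter_upwards [hk_le, eventually_ge_atTop 1] with n hle h1
      obtain ⟨i, hi1, hi2, hi⟩ := (hY n h1 hle ω).exists_eq (hk n h1) hle
      rw [hi, ← dist_eq_norm, dist_comm]
      exact hb.trans_le (Metric.infDist_le_dist_of_mem (hlow n i hi1 hi2))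
    · obtain ⟨j, hj⟩ := exists_nat_one_div_lt (sub_pos.2 hb)
      filter_upwards [hup j] with n hn
      linarith
  exact ⟨hmain, fun hx => by simpa only [Metric.infDist_zero_of_mem hx] using hmain⟩
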